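/- **Proposition 3.10.** Let $\mathbb H$ be the quaternions and let $V$ be a two-sided quaternionic Banach space: a real Banach space with commuting left and right multiplications by $\mathbb H$ which are continuous (for instance $\|qv\|=\|vq\|=|q|\,\|v\|$) and which, for real scalars, both coincide with the real scalar multiplication of $V$. Let $T:\mathcal D(T)\to V$ be a (single valued, possibly unbounded) right linear or left linear operator, whose domain $\mathcal D(T)\subseteq V$ is a right, respectively left, $\mathbb H$-linear subspace. Sums and products of operators have their maximal domains, $\mathcal D(A+B)=\mathcal D(A)\cap\mathcal D(B)$ and $\mathcal D(BA)=\{v\in\mathcal D(A): Av\in\mathcal D(B)\}$; $T^0=\mathcal I$ on $V$ and $T^{k+1}=T\,T^k$. The inverse of an injective operator is defined on its range. A quaternionic polynomial $P(q)=\sum_{\ell=0}^n a_\ell q^\ell$ is *intrinsic* if $P(\mathbb C_i)\subset\mathbb C_i$ for every $i\in\mathbb H$ with $i^2=-1$, where $\mathbb C_i=\{u+iv:u,v\in\mathbb R\}$ (equivalently, its coefficients are real). For such $P$ of degree $n$ put $P(T)=\sum_{\ell=0}^n a_\ell T^\ell$ with $\mathcal D(P(T))=\mathcal D(T^n)$;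 for $P=0$ let $P(T)=0$ on $V$. For an operator $A$ linear on the same side as $T$, let $\rho_S(A)$ be the set of all $s\in\mathbb H$ for which $A^2-2\operatorname{Re}(s)A+|s|^2\mathcal I:\mathcal D(A^2)\to V$ is bijective with a bounded inverse $V\to V$, and let $\sigma_S(A)=\mathbb H\setminus\rho_S(A)$. Let $P$ and $Q$ be intrinsic polynomials. Then: (i) If $P\neq0$, then $P(T)Q(T)=(PQ)(T)$, with equality of domains. (ii) If $P(T)$ is injective and $Q\neq0$, then $$\mathcal D(P(T)^{-1})\cap\mathcal D(Q(T))\subset\mathcal D(P(T)^{-1}Q(T))\cap\mathcal D(Q(T)P(T)^{-1})$$ and $P(T)^{-1}Q(T)v=Q(T)P(T)^{-1}v$ for all $v\in\mathcal D(Q(T))\cap\mathcal D(P(T)^{-1})$. (iii) Suppose that $T$ is closed and $\rho_S(T)\neq\emptyset$. Then $P(T)$ is closed. If, moreover, $P$ is non-constant or $\sigma_S(T)\neq\emptyset$, then $P(\sigma_S(T))=\sigma_S(P(T))$. -/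

import Mathlib

open scoped Quaternion Polynomial

/-! ### Quaternionic imaginary units, slices, intrinsic polynomials -/

/-- The sphere `𝕊` of imaginary units: all quaternions with square `-1`. -/
def imaginaryUnits : Set ℍ[ℝ] := {i | i ^ 2 = -1}

/-- The complex plane `ℂ_i = {u + i v : u, v ∈ ℝ}` attached to `i ∈ 𝕊`. -/
def slicePlane (i : ℍ[ℝ]) : Set ℍ[ℝ] := {q | ∃ u v : ℝ, q = (u : ℍ[ℝ]) + i * (v : ℍ[ℝ])}

/-- A quaternionic polynomial `P(q) = ∑ a_ℓ q ^ ℓ` is intrinsic if it maps every plane `ℂ_i`,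
`i ∈ 𝕊`, into itself. (`P.eval q` is `∑ a_ℓ q ^ ℓ`, with the coefficients on the left; such a
polynomial function is automatically slice hyperholomorphic.) -/
def IsIntrinsicPolynomial (P : ℍ[ℝ][X]) : Prop :=
  ∀ i ∈ imaginaryUnits, ∀ q ∈ slicePlane i, P.eval q ∈ slicePlane i

/-! ### Unbounded operators

`V →ₗ.[R] V` is the type of single valued `R`-linear operators whose domain is an `R`-submodule
of `V`. Sums and scalar multiples are Mathlib's: the domain of a sum is the intersection of the
domains, and a scalar multiple (also by `0`) keeps the domain. -/

namespace UnboundedOp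

section

variable {R V : Type*} [Ring R] [AddCommGroup V] [Module R V]

/-- The product `B A` with its maximal domain `{v ∈ D(A) : A v ∈ D(B)}`. -/
noncomputable def prod (B A : V →ₗ.[R] V) : V →ₗ.[R] V :=
  B.comp (A.domRestrict ((B.domain.comap A.toFun).map A.domain.subtype)) (by
    rintro ⟨x, hx⟩
    obtain ⟨⟨y, hy, hyx⟩, hxA⟩ := hx
    obtain rfl : (y : V) = x := hyx
    exact hy)

theorem mem_prod_domain {B A : V →ₗ.[R] V} {v : V} :
    v ∈ (prod B A).domain ↔ ∃ h : v ∈ A.domain, A ⟨v, h⟩ ∈ B.domain := by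
  constructor
  · rintro ⟨⟨y, hy, hyx⟩, hA⟩
    obtain rfl : (y : V) = v := hyx
    exact ⟨hA, hy⟩
  · rintro ⟨h, hB⟩
    exact ⟨⟨⟨v, h⟩, hB, rfl⟩, h⟩

theorem prod_apply {B A : V →ₗ.[R] V} {v : V} (h : v ∈ A.domain) (hB : A ⟨v, h⟩ ∈ B.domain)
    (h' : v ∈ (prod B A).domain) : prod B A ⟨v, h'⟩ = B ⟨A ⟨v, h⟩, hB⟩ := rfl

/-- The identity, with domain `V`. -/
def one (R V : Type*) [Ring R] [AddCommGroup V] [Module R V] : V →ₗ.[R] V :=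
  ⟨⊤, Submodule.subtype ⊤⟩

/-- The powers `T ^ 0 = I`, `T ^ (n + 1) = T T ^ n` on
`D(T ^ (n + 1)) = {v ∈ D(T ^ n) : T ^ n v ∈ D(T)}`. -/
noncomputable def pow (T : V →ₗ.[R] V) : ℕ → (V →ₗ.[R] V)
  | 0 => one R V
  | n + 1 => prod T (pow T n)

/-- The operator `∑_{ℓ ≤ n} a_ℓ T ^ ℓ`; its domain is `D(T ^ n)`. The scalars `a_ℓ` come from a
ring (or monoid) acting on `V` and commuting with the scalars for which `T` is linear. -/
noncomputable def polySum {S : Type*} [Monoid S] [DistribMulAction S V] [SMulCommClass R S V]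
    (n : ℕ) (a : ℕ → S) (T : V →ₗ.[R] V) : V →ₗ.[R] V :=
  ∑ l ∈ Finset.range (n + 1), a l • pow T l

theorem pow_succ_domain_le (T : V →ₗ.[R] V) (n : ℕ) :
    (pow T (n + 1)).domain ≤ (pow T n).domain := fun _ hv => (mem_prod_domain.1 hv).1

theorem polySum_domain {S : Type*} [Monoid S] [DistribMulAction S V] [SMulCommClass R S V]
    (n : ℕ) (a : ℕ → S) (T : V →ₗ.[R] V) : (polySum n a T).domain = (pow T n).domain := by
  induction n with
  | zero => simp [polySum]
  | succ n ih =>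
    rw [polySum, Finset.sum_range_succ, LinearPMap.add_domain]
    change (polySum n a T).domain ⊓ (pow T (n + 1)).domain = _
    rw [ih]
    exact inf_eq_right.2 (pow_succ_domain_le T n)

/-- An operator is injective on its domain. -/
def Injective (T : V →ₗ.[R] V) : Prop := Function.Injective fun v : T.domain => T v

/-- An operator is closed if its graph is closed in `V × V`. -/
def IsClosedOp [TopologicalSpace V] (T : V →ₗ.[R] V) : Prop := IsClosed (T.graph : Set (V × V))

end

section

variable {R V : Type*} [Ring R] [NormedAddCommGroup V] [NormedSpace ℝ V] [Module R V]
  [SMulCommClass R ℝ V]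

/-- The operator `T ^ 2 - 2 Re(s) T + |s| ^ 2 I : D(T ^ 2) → V`. -/
noncomputable def quadratic (T : V →ₗ.[R] V) (s : ℍ[ℝ]) : V →ₗ.[R] V :=
  pow T 2 - (2 * s.re) • T + (‖s‖ ^ 2) • one R V

/-- The `S`-resolvent set: those `s` for which `T ^ 2 - 2 Re(s) T + |s| ^ 2 I : D(T ^ 2) → V` is
bijective and its inverse is a bounded (`R`-linear) operator on `V`. -/
def sResolventSet (T : V →ₗ.[R] V) : Set ℍ[ℝ] :=
  {s | Function.Bijective (fun v : (quadratic T s).domain => quadratic T s v) ∧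
    ∃ B : V →L[R] V, ∀ v : (quadratic T s).domain, B (quadratic T s v) = v}

/-- The `S`-spectrum. -/
def sSpectrum (T : V →ₗ.[R] V) : Set ℍ[ℝ] := (sResolventSet T)ᶜ

end

section

variable {V : Type*} [AddCommGroup V] [Module ℍ[ℝ] V] [Module ℍ[ℝ]ᵐᵒᵖ V]

/-- `P(T) = ∑ a_ℓ T ^ ℓ` on `D(T ^ deg P)` for a right linear operator `T`. Right multiplication
of vectors by quaternions is the action of `ℍᵐᵒᵖ`; the coefficients multiply vectors from the
left, so that `P(T)` is again right linear. The zero polynomial gives the zero operator on `V`. -/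
noncomputable def evalRight [SMulCommClass ℍ[ℝ]ᵐᵒᵖ ℍ[ℝ] V] (P : ℍ[ℝ][X])
    (T : V →ₗ.[ℍ[ℝ]ᵐᵒᵖ] V) : V →ₗ.[ℍ[ℝ]ᵐᵒᵖ] V :=
  polySum P.natDegree P.coeff T

/-- `P(T)` on `D(T ^ deg P)` for a left linear operator `T`: here the coefficients multiply
vectors from the right, `P(T) v = ∑ (T ^ ℓ v) a_ℓ`, so that `P(T)` is again left linear. (The
coefficients of an intrinsic polynomial are real and the side does not matter.) -/
noncomputable def evalLeft [SMulCommClass ℍ[ℝ] ℍ[ℝ]ᵐᵒᵖ V] (P : ℍ[ℝ][X])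
    (T : V →ₗ.[ℍ[ℝ]] V) : V →ₗ.[ℍ[ℝ]] V :=
  polySum P.natDegree (fun l => MulOpposite.op (P.coeff l)) T

end

end UnboundedOp

/-! An intrinsic polynomial has real coefficients: for real x the value P(x) lies in two different
planes ℂ_i, hence is real. Real scalars act alike from both sides, so left and right linear
operators are covered by one calculus of real polynomials in T (`realEval`).

For products and inverses the only difficulty is domains. If q ≠ 0 and q(T)v lies in D(T^n), then v
lies in D(T^(deg q + n)): the lower order terms are already regular enough, so the leading one is
too (`mem_pow_domain_of_orbitEval_mem`).

For closedness, divide p by the quadratic q attached to a point of the resolvent set. The bounded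
inverse B of q(T) commutes with T, and TB is bounded, so p(T) controls the quotient of degree deg p
- 2; induction applies (`isClosedOp_realEval`).

For spectra, the quadratic operator of p(T) at s is (q_s ∘ p)(T) with q_s = X² - 2 Re(s) X + |s|².
Since this operator is closed, the closed graph theorem reduces membership in the resolvent set to
bijectivity. Identifying s with a complex number z, q_s ∘ p = (p - z)(p - z̄) is a constant times
the product of the q_w over the complex roots w of p = z (`charQuadratic_comp_eq_prod`). A product
of commuting operators is bijective exactly when every factor is, which is the spectral mapping
theorem. -/

namespace UnboundedOp

/-! ### Powers and inverses: bookkeeping of domains. -/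

section Algebra

variable {R V : Type*} [Ring R] [AddCommGroup V] [Module R V]

open Classical in
/-- The function `V → V` that agrees with `T` on `D(T)` and vanishes elsewhere. -/
noncomputable def extendByZero (T : V →ₗ.[R] V) (v : V) : V :=
  if h : v ∈ T.domain then T ⟨v, h⟩ else 0

theorem extendByZero_apply (T : V →ₗ.[R] V) {v : V} (h : v ∈ T.domain) :
    extendByZero T v = T ⟨v, h⟩ := dif_pos h

/-- Iterating a total function removes membership proofs from the terms; identities between powers
become rewrites among vectors. -/
theorem pow_apply (T : V →ₗ.[R] V) (n : ℕ) {v : V} (h : v ∈ (pow T n).domain) :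
    pow T n ⟨v, h⟩ = (extendByZero T)^[n] v := by
  induction n with
  | zero => rfl
  | succ n ih =>
    obtain ⟨h₁, h₂⟩ := mem_prod_domain.1 h
    rw [Function.iterate_succ_apply', ← ih h₁, extendByZero_apply T h₂]
    exact prod_apply h₁ h₂ h

theorem mem_pow_succ_domain (T : V →ₗ.[R] V) (n : ℕ) {v : V} :
    v ∈ (pow T (n + 1)).domain ↔ v ∈ (pow T n).domain ∧ (extendByZero T)^[n] v ∈ T.domain := by
  refine mem_prod_domain.trans ⟨fun ⟨h₁, h₂⟩ => ⟨h₁, ?_⟩, fun ⟨h₁, h₂⟩ => ⟨h₁, ?_⟩⟩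
  · rwa [pow_apply] at h₂
  · rwa [pow_apply]

theorem mem_pow_domain_iff (T : V →ₗ.[R] V) (n : ℕ) {v : V} :
    v ∈ (pow T n).domain ↔ ∀ k < n, (extendByZero T)^[k] v ∈ T.domain := by
  induction n with
  | zero => simp [pow, one]
  | succ n ih => rw [mem_pow_succ_domain, ih, Nat.forall_lt_succ_right]

@[simp]
theorem mem_pow_zero_domain (T : V →ₗ.[R] V) (v : V) : v ∈ (pow T 0).domain := trivial

theorem pow_domain_antitone (T : V →ₗ.[R] V) {m n : ℕ} (h : m ≤ n) :
    (pow T n).domain ≤ (pow T m).domain := fun _ hv =>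
  (mem_pow_domain_iff T m).2 fun k hk => (mem_pow_domain_iff T n).1 hv k (hk.trans_le h)

theorem mem_pow_one_domain (T : V →ₗ.[R] V) {v : V} : v ∈ (pow T 1).domain ↔ v ∈ T.domain := by
  simp [mem_pow_domain_iff]

theorem mem_pow_add_domain (T : V →ₗ.[R] V) (m n : ℕ) {v : V} :
    v ∈ (pow T (m + n)).domain ↔
      v ∈ (pow T m).domain ∧ (extendByZero T)^[m] v ∈ (pow T n).domain := by
  induction n with
  | zero => simp
  | succ n ih =>
    rw [← add_assoc, mem_pow_succ_domain, ih, mem_pow_succ_domain, add_comm m n,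
      Function.iterate_add_apply, and_assoc]

theorem iterate_mem_pow_domain (T : V →ₗ.[R] V) {m n : ℕ} {v : V}
    (hv : v ∈ (pow T (m + n)).domain) : (extendByZero T)^[m] v ∈ (pow T n).domain :=
  ((mem_pow_add_domain T m n).1 hv).2

theorem polySum_apply {S : Type*} [Monoid S] [DistribMulAction S V] [SMulCommClass R S V]
    (n : ℕ) (a : ℕ → S) (T : V →ₗ.[R] V) {v : V} (h : v ∈ (polySum n a T).domain) :
    polySum n a T ⟨v, h⟩ = ∑ l ∈ Finset.range (n + 1), a l • (extendByZero T)^[l] v := by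
  have key : ∀ (m : ℕ) (h : v ∈ (∑ l ∈ Finset.range m, a l • pow T l).domain),
      (∑ l ∈ Finset.range m, a l • pow T l) ⟨v, h⟩
        = ∑ l ∈ Finset.range m, a l • (extendByZero T)^[l] v := by
    intro m
    induction m with
    | zero => intro h; rfl
    | succ m ih =>
      rw [Finset.sum_range_succ, Finset.sum_range_succ]
      intro h
      rw [LinearPMap.add_domain] at h
      rw [← ih h.1, ← pow_apply T m h.2]
      rfl
  exact key (n + 1) h

theorem Injective.ker_eq_bot {A : V →ₗ.[R] V} (h : Injective A) : A.toFun.ker = ⊥ :=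
  LinearMap.ker_eq_bot.2 h

theorem Injective.inverse_apply {A : V →ₗ.[R] V} (hA : Injective A) {v w : V}
    (hv : v ∈ A.domain) (hw : A ⟨v, hv⟩ = w) (h : w ∈ A.inverse.domain) :
    A.inverse ⟨w, h⟩ = v :=
  LinearPMap.inverse_apply_eq hA.ker_eq_bot (x := ⟨v, hv⟩) hw

theorem mem_inverse_domain {A : V →ₗ.[R] V} {w : V} :
    w ∈ A.inverse.domain ↔ ∃ v, ∃ h : v ∈ A.domain, A ⟨v, h⟩ = w := by
  rw [LinearPMap.inverse_domain, LinearMap.mem_range]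
  exact ⟨fun ⟨v, hv⟩ => ⟨v, v.2, hv⟩, fun ⟨v, h, hv⟩ => ⟨⟨v, h⟩, hv⟩⟩

/-- Commuting operators: the inverse of one commutes with the other. -/
theorem inverse_commutes {A B : V →ₗ.[R] V} (hA : Injective A) (hAB : prod B A = prod A B) :
    A.inverse.domain ⊓ B.domain ≤ (prod A.inverse B).domain ⊓ (prod B A.inverse).domain ∧
      ∀ (v : V) (h₁ : v ∈ (prod A.inverse B).domain) (h₂ : v ∈ (prod B A.inverse).domain),
        v ∈ B.domain → v ∈ A.inverse.domain →
        prod A.inverse B ⟨v, h₁⟩ = prod B A.inverse ⟨v, h₂⟩ := by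
  -- With v = A w, the condition v ∈ D(B) says w ∈ D(BA) = D(AB). Hence A B w = B v, and B w is the
  -- common value of both products at v.
  have key : ∀ v, ∀ hi : v ∈ A.inverse.domain, ∀ hB : v ∈ B.domain,
      ∃ w, ∃ hwA : w ∈ A.domain, ∃ hwB : w ∈ B.domain, ∃ hBw : B ⟨w, hwB⟩ ∈ A.domain,
        A ⟨w, hwA⟩ = v ∧ A ⟨B ⟨w, hwB⟩, hBw⟩ = B ⟨v, hB⟩ := by
    intro v hi hB
    obtain ⟨w, hwA, rfl⟩ := mem_inverse_domain.1 hi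
    have hBA : w ∈ (prod B A).domain := mem_prod_domain.2 ⟨hwA, hB⟩
    have hAB' : w ∈ (prod A B).domain := hAB ▸ hBA
    obtain ⟨hwB, hBw⟩ := mem_prod_domain.1 hAB'
    refine ⟨w, hwA, hwB, hBw, rfl, ?_⟩
    rw [← prod_apply hwB hBw hAB', ← prod_apply hwA hB hBA]
    exact ((LinearPMap.ext_iff.1 hAB).2 (hf := hBA) (hg := hAB')).symm
  constructor
  · rintro v ⟨hi, hB⟩
    obtain ⟨w, hwA, hwB, hBw, hw, hBw'⟩ := key v hi hB
    refine ⟨mem_prod_domain.2 ⟨hB, mem_inverse_domain.2 ⟨_, hBw, hBw'⟩⟩,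
      mem_prod_domain.2 ⟨hi, ?_⟩⟩
    rwa [hA.inverse_apply hwA hw hi]
  · intro v h₁ h₂ hB hi
    obtain ⟨w, hwA, hwB, hBw, hw, hBw'⟩ := key v hi hB
    rw [prod_apply hB (mem_inverse_domain.2 ⟨_, hBw, hBw'⟩) h₁, hA.inverse_apply hBw hBw']
    obtain ⟨hi', hBi⟩ := mem_prod_domain.1 h₂
    rw [prod_apply hi' hBi h₂]
    congr 2
    exact (hA.inverse_apply hwA hw hi').symm

/-! ### Real polynomials of an operator and their products. -/

section Real

variable [Module ℝ V]

/-- The value `∑ a_ℓ T ^ ℓ v` as a function of the polynomial `∑ a_ℓ X ^ ℓ`. -/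
noncomputable def orbitEval (T : V →ₗ.[R] V) (v : V) : ℝ[X] →ₗ[ℝ] V :=
  Polynomial.lsum fun l => LinearMap.toSpanSingleton ℝ V ((extendByZero T)^[l] v)

theorem orbitEval_eq_sum (T : V →ₗ.[R] V) (v : V) (p : ℝ[X]) :
    orbitEval T v p
      = ∑ l ∈ Finset.range (p.natDegree + 1), p.coeff l • (extendByZero T)^[l] v := by
  simp only [orbitEval, Polynomial.lsum_apply, LinearMap.toSpanSingleton_apply]
  exact Polynomial.sum_over_range p fun n => zero_smul ℝ _

theorem orbitEval_monomial (T : V →ₗ.[R] V) (v : V) (n : ℕ) (a : ℝ) :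
    orbitEval T v (Polynomial.monomial n a) = a • (extendByZero T)^[n] v := by
  simp [orbitEval, Polynomial.sum_monomial_index]

@[simp]
theorem orbitEval_C (T : V →ₗ.[R] V) (v : V) (a : ℝ) :
    orbitEval T v (Polynomial.C a) = a • v := orbitEval_monomial T v 0 a

theorem orbitEval_X_pow (T : V →ₗ.[R] V) (v : V) (n : ℕ) :
    orbitEval T v (Polynomial.X ^ n) = (extendByZero T)^[n] v := by
  rw [Polynomial.X_pow_eq_monomial, orbitEval_monomial, one_smul]

@[simp]
theorem orbitEval_X (T : V →ₗ.[R] V) (v : V) :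
    orbitEval T v Polynomial.X = extendByZero T v := by
  simpa using orbitEval_X_pow T v 1

theorem orbitEval_zero_left (T : V →ₗ.[R] V) (p : ℝ[X]) : orbitEval T 0 p = 0 := by
  have h (k : ℕ) : (extendByZero T)^[k] 0 = 0 :=
    (pow_apply T k (Submodule.zero_mem _)).symm.trans (pow T k).map_zero
  simp [orbitEval_eq_sum, h]

variable [SMulCommClass R ℝ V]

/-- `P(T)` on `D(T ^ deg P)` for a polynomial with real coefficients. -/
noncomputable def realEval (p : ℝ[X]) (T : V →ₗ.[R] V) : V →ₗ.[R] V :=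
  polySum p.natDegree p.coeff T

theorem realEval_domain (p : ℝ[X]) (T : V →ₗ.[R] V) :
    (realEval p T).domain = (pow T p.natDegree).domain := polySum_domain _ _ _

theorem realEval_apply (p : ℝ[X]) (T : V →ₗ.[R] V) {v : V} (h : v ∈ (realEval p T).domain) :
    realEval p T ⟨v, h⟩ = orbitEval T v p :=
  (polySum_apply _ _ _ h).trans (orbitEval_eq_sum T v p).symm

theorem eq_realEval {p : ℝ[X]} {T A : V →ₗ.[R] V}
    (hd : ∀ v, v ∈ A.domain ↔ v ∈ (pow T p.natDegree).domain)
    (ha : ∀ v (h : v ∈ A.domain), A ⟨v, h⟩ = orbitEval T v p) : A = realEval p T :=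
  LinearPMap.ext (SetLike.ext fun v => by rw [hd, realEval_domain]) fun v h h' => by
    rw [ha, realEval_apply]

theorem mem_prod_realEval_domain {p q : ℝ[X]} {T : V →ₗ.[R] V} {v : V} :
    v ∈ (prod (realEval p T) (realEval q T)).domain ↔
      v ∈ (pow T q.natDegree).domain ∧ orbitEval T v q ∈ (pow T p.natDegree).domain := by
  simp only [mem_prod_domain, realEval_domain, realEval_apply, exists_prop]

theorem realEval_zero_apply (T : V →ₗ.[R] V) (v : (realEval 0 T).domain) : realEval 0 T v = 0 := by
  rw [show v = ⟨v.1, v.2⟩ from rfl, realEval_apply, map_zero]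

end Real

variable [Algebra ℝ R] [Module ℝ V] [IsScalarTower ℝ R V]

theorem real_smul_mem (p : Submodule R V) (r : ℝ) {v : V} (hv : v ∈ p) : r • v ∈ p := by
  rw [← algebraMap_smul R r v]
  exact p.smul_mem _ hv

/-- Extension by zero destroys linearity; it survives for vectors in the domain, which is closed
under real combinations because reals act through `algebraMap ℝ R`. -/
theorem iterate_sum_smul (T : V →ₗ.[R] V) (k : ℕ) {ι : Type*} (s : Finset ι) (c : ι → ℝ)
    (g : ι → V) (hg : ∀ i ∈ s, g i ∈ (pow T k).domain) :
    ∑ i ∈ s, c i • g i ∈ (pow T k).domain ∧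
      (extendByZero T)^[k] (∑ i ∈ s, c i • g i) = ∑ i ∈ s, c i • (extendByZero T)^[k] (g i) := by
  classical
  induction s using Finset.induction_on with
  | empty =>
    have h := Submodule.zero_mem (pow T k).domain
    refine ⟨by simp, ?_⟩
    rw [Finset.sum_empty, Finset.sum_empty, ← pow_apply T k h]
    exact (pow T k).map_zero
  | insert i s hi ih =>
    obtain ⟨h₁, h₂⟩ := ih fun j hj => hg j (Finset.mem_insert_of_mem hj)
    have hgi := hg i (Finset.mem_insert_self i s)
    have h₃ := real_smul_mem _ (c i) hgi
    rw [Finset.sum_insert hi, Finset.sum_insert hi, ← h₂, ← pow_apply T k hgi,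
      ← pow_apply T k h₁, ← pow_apply T k (Submodule.add_mem _ h₃ h₁)]
    refine ⟨Submodule.add_mem _ h₃ h₁, ?_⟩
    rw [← algebraMap_smul R (c i) (pow T k ⟨g i, hgi⟩), ← LinearPMap.map_smul,
      ← LinearPMap.map_add]
    congr 1
    ext
    simp

theorem iterate_orbitEval (T : V →ₗ.[R] V) (k : ℕ) (q : ℝ[X]) {v : V}
    (hv : v ∈ (pow T (q.natDegree + k)).domain) :
    orbitEval T v q ∈ (pow T k).domain ∧
      (extendByZero T)^[k] (orbitEval T v q) = orbitEval T v (Polynomial.X ^ k * q) := by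
  have h := iterate_sum_smul T k (Finset.range (q.natDegree + 1)) q.coeff
    (fun l => (extendByZero T)^[l] v) fun l hl =>
      iterate_mem_pow_domain T (pow_domain_antitone T
        (Nat.add_le_add_right (Nat.lt_succ_iff.1 (Finset.mem_range.1 hl)) k) hv)
  rw [orbitEval_eq_sum]
  refine ⟨h.1, h.2.trans ?_⟩
  conv_rhs => rw [q.as_sum_range_C_mul_X_pow, Finset.mul_sum, map_sum]
  refine Finset.sum_congr rfl fun l _ => ?_
  rw [mul_left_comm, ← pow_add, Polynomial.C_mul_X_pow_eq_monomial, orbitEval_monomial,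
    Function.iterate_add_apply]

theorem orbitEval_orbitEval (T : V →ₗ.[R] V) (p q : ℝ[X]) {v : V}
    (hv : v ∈ (pow T (q.natDegree + p.natDegree)).domain) :
    orbitEval T (orbitEval T v q) p = orbitEval T v (p * q) := by
  conv_rhs => rw [p.as_sum_range_C_mul_X_pow, Finset.sum_mul, map_sum]
  rw [orbitEval_eq_sum]
  refine Finset.sum_congr rfl fun l hl => ?_
  rw [(iterate_orbitEval T l q (pow_domain_antitone T (Nat.add_le_add_left
    (Nat.lt_succ_iff.1 (Finset.mem_range.1 hl)) _) hv)).2, mul_assoc, ← Polynomial.smul_eq_C_mul,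
    map_smul]

/-- In the induction v is already in D(T^(deg q + n)), so T^l v ∈ D(T^(n+1)) for every l < deg q.
Subtracting these terms and dividing by the leading coefficient leaves T^(deg q) v ∈ D(T^(n+1)). -/
theorem mem_pow_domain_of_orbitEval_mem (T : V →ₗ.[R] V) (n : ℕ) {q : ℝ[X]} (hq : q ≠ 0) {v : V}
    (hv : v ∈ (pow T q.natDegree).domain) (h : orbitEval T v q ∈ (pow T n).domain) :
    v ∈ (pow T (q.natDegree + n)).domain := by
  induction n with
  | zero => exact hv
  | succ n ih =>
    have hvn := ih (pow_domain_antitone T n.le_succ h)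
    refine (mem_pow_add_domain T _ _).2 ⟨hv, ?_⟩
    rw [orbitEval_eq_sum, Finset.sum_range_succ] at h
    have hlow := (iterate_sum_smul T (n + 1) (Finset.range q.natDegree) q.coeff
      (fun l => (extendByZero T)^[l] v) fun l hl => iterate_mem_pow_domain T
        (pow_domain_antitone T (by have := Finset.mem_range.1 hl; omega) hvn)).1
    have htop := real_smul_mem _ q.leadingCoeff⁻¹ ((Submodule.add_mem_iff_right _ hlow).1 h)
    rwa [Polynomial.coeff_natDegree, inv_smul_smul₀ (Polynomial.leadingCoeff_ne_zero.2 hq)] at htop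

theorem orbitEval_mem_pow_domain_iff (T : V →ₗ.[R] V) (n : ℕ) {q : ℝ[X]} (hq : q ≠ 0) {v : V}
    (hv : v ∈ (pow T q.natDegree).domain) :
    orbitEval T v q ∈ (pow T n).domain ↔ v ∈ (pow T (q.natDegree + n)).domain :=
  ⟨mem_pow_domain_of_orbitEval_mem T n hq hv, fun h => (iterate_orbitEval T n q h).1⟩

variable [SMulCommClass R ℝ V]

/-- For p = 0 the left side would keep the domain D(T^(deg q)), while the zero polynomial gives all
of V. The case q = 0 is harmless, since 0 lies in every domain. -/
theorem prod_realEval {p : ℝ[X]} (hp : p ≠ 0) (q : ℝ[X]) (T : V →ₗ.[R] V) :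
    prod (realEval p T) (realEval q T) = realEval (p * q) T := by
  refine eq_realEval (fun v => ?_) fun v h => ?_
  · rw [mem_prod_realEval_domain]
    rcases eq_or_ne q 0 with rfl | hq
    · simp
    · rw [Polynomial.natDegree_mul hp hq, add_comm]
      exact ⟨fun h => (orbitEval_mem_pow_domain_iff T _ hq h.1).1 h.2, fun h =>
        ⟨pow_domain_antitone T (Nat.le_add_right _ _) h, (iterate_orbitEval T _ q h).1⟩⟩
  · have h' := mem_prod_realEval_domain.1 h
    obtain ⟨h₁, h₂⟩ := mem_prod_domain.1 h
    rw [prod_apply h₁ h₂ h, realEval_apply, realEval_apply]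
    rcases eq_or_ne q 0 with rfl | hq
    · rw [mul_zero, map_zero, orbitEval_zero_left]
    · exact orbitEval_orbitEval T p q ((orbitEval_mem_pow_domain_iff T _ hq h'.1).1 h'.2)

theorem realEval_prod_comm_of_injective {p q : ℝ[X]} (hq : q ≠ 0) (T : V →ₗ.[R] V)
    (hp : Injective (realEval p T)) :
    prod (realEval q T) (realEval p T) = prod (realEval p T) (realEval q T) := by
  -- The zero operator on V is injective only when V = 0, and then there is nothing to compare.
  rcases eq_or_ne p 0 with rfl | hp0
  · have hsub : ∀ v : V, v = 0 := fun v => by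
      have hv : ∀ v : V, v ∈ (realEval 0 T).domain := fun v => by simp [realEval_domain]
      have := @hp ⟨v, hv v⟩ ⟨0, hv 0⟩ (by
        simp only [realEval_zero_apply])
      exact congrArg Subtype.val this
    refine LinearPMap.ext (SetLike.ext fun v => ?_) fun v _ _ => (hsub _).trans (hsub _).symm
    rw [hsub v]
    simp
  · rw [prod_realEval hq, prod_realEval hp0, mul_comm]

end Algebra

end UnboundedOp

namespace UnboundedOp

/-- The polynomial `X ^ 2 - 2 a X + r ^ 2`, whose roots have real part `a` and modulus `r` as soon
as `|a| ≤ r`. -/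
noncomputable def charQuadratic (a r : ℝ) : ℝ[X] :=
  Polynomial.X ^ 2 - Polynomial.C (2 * a) * Polynomial.X + Polynomial.C (r ^ 2)

theorem charQuadratic_monic (a r : ℝ) : (charQuadratic a r).Monic := by
  rw [charQuadratic]
  monicity!

theorem natDegree_charQuadratic (a r : ℝ) : (charQuadratic a r).natDegree = 2 := by
  rw [charQuadratic]
  compute_degree!

theorem charQuadratic_comp (a r : ℝ) (p : ℝ[X]) :
    (charQuadratic a r).comp p = p * p - (2 * a) • p + Polynomial.C (r ^ 2) := by
  simp [charQuadratic, sq, Polynomial.smul_eq_C_mul]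

open Filter Topology

/-! ### Bijectivity of products and of their commuting factors. -/

section Bijective

variable {R V : Type*} [Ring R] [AddCommGroup V] [Module R V]

/-- An operator maps its domain bijectively onto the whole space. -/
def Bijective (A : V →ₗ.[R] V) : Prop := Function.Bijective fun v : A.domain => A v

theorem Bijective.prod {A B : V →ₗ.[R] V} (hA : Bijective A) (hB : Bijective B) :
    Bijective (prod A B) := by
  constructor
  · rintro ⟨v, hv⟩ ⟨w, hw⟩ h
    obtain ⟨hv₁, hv₂⟩ := mem_prod_domain.1 hv
    obtain ⟨hw₁, hw₂⟩ := mem_prod_domain.1 hw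
    have h₁ := congrArg Subtype.val (hA.1 (a₁ := ⟨_, hv₂⟩) (a₂ := ⟨_, hw₂⟩) h)
    obtain rfl : v = w := congrArg Subtype.val (hB.1 (a₁ := ⟨v, hv₁⟩) (a₂ := ⟨w, hw₁⟩) h₁)
    rfl
  · intro w
    obtain ⟨⟨u, hu⟩, rfl⟩ := hA.2 w
    obtain ⟨⟨v, hv⟩, rfl⟩ := hB.2 u
    exact ⟨⟨v, mem_prod_domain.2 ⟨hv, hu⟩⟩, rfl⟩

/-- Surjectivity of A is read off from AB, injectivity from BA. -/
theorem Bijective.of_prod_comm {A B : V →ₗ.[R] V} (h : Bijective (UnboundedOp.prod A B))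
    (hc : UnboundedOp.prod A B = UnboundedOp.prod B A) : Bijective A := by
  constructor
  · refine (LinearMap.ker_eq_bot (f := A.toFun)).1 (LinearMap.ker_eq_bot'.2 ?_)
    rintro ⟨v, hv⟩ hv0
    replace hv0 : A ⟨v, hv⟩ = 0 := hv0
    -- A kernel vector of A is automatically in D(BA), because A v = 0 ∈ D(B).
    have hm : v ∈ (UnboundedOp.prod B A).domain :=
      mem_prod_domain.2 ⟨hv, by rw [hv0]; exact Submodule.zero_mem _⟩
    rw [hc] at h
    have : UnboundedOp.prod B A ⟨v, hm⟩ = UnboundedOp.prod B A 0 := by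
      rw [prod_apply hv (mem_prod_domain.1 hm).2 hm, LinearPMap.map_zero]
      have : (⟨A ⟨v, hv⟩, (mem_prod_domain.1 hm).2⟩ : B.domain) = 0 := Subtype.ext hv0
      rw [this, LinearPMap.map_zero]
    have h0 : v = 0 := congrArg Subtype.val (h.1 this)
    exact Subtype.ext h0
  · intro w
    obtain ⟨⟨v, hv⟩, rfl⟩ := h.2 w
    obtain ⟨h₁, h₂⟩ := mem_prod_domain.1 hv
    exact ⟨⟨_, h₂⟩, rfl⟩

section Real

variable [Module ℝ V] [SMulCommClass R ℝ V]

theorem bijective_realEval_C {a : ℝ} (ha : a ≠ 0) (T : V →ₗ.[R] V) :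
    Bijective (realEval (Polynomial.C a) T) := by
  have hd (v : V) : v ∈ (realEval (Polynomial.C a) T).domain := by simp [realEval_domain]
  constructor
  · rintro ⟨v, hv⟩ ⟨w, hw⟩ h
    simp only [realEval_apply, orbitEval_C] at h
    exact Subtype.ext ((smul_right_injective V ha) h)
  · intro w
    refine ⟨⟨a⁻¹ • w, hd _⟩, ?_⟩
    simp only [realEval_apply, orbitEval_C, smul_inv_smul₀ ha]

theorem realEval_X (T : V →ₗ.[R] V) : realEval Polynomial.X T = T :=
  (eq_realEval (fun v => by rw [Polynomial.natDegree_X, mem_pow_one_domain]) fun v h => by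
    rw [orbitEval_X, extendByZero_apply T h]).symm

end Real

variable [Algebra ℝ R] [Module ℝ V] [IsScalarTower ℝ R V] [SMulCommClass R ℝ V]

theorem bijective_realEval_mul {p q : ℝ[X]} (hp : p ≠ 0) (hq : q ≠ 0) (T : V →ₗ.[R] V) :
    Bijective (realEval (p * q) T) ↔ Bijective (realEval p T) ∧ Bijective (realEval q T) := by
  have hc : prod (realEval p T) (realEval q T) = prod (realEval q T) (realEval p T) := by
    rw [prod_realEval hp, prod_realEval hq, mul_comm]
  rw [← prod_realEval hp]
  exact ⟨fun h => ⟨h.of_prod_comm hc, (hc ▸ h).of_prod_comm hc.symm⟩, fun h => h.1.prod h.2⟩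

theorem bijective_realEval_multiset_prod {ι : Type*} (s : Multiset ι) (f : ι → ℝ[X])
    (hf : ∀ i, f i ≠ 0) (T : V →ₗ.[R] V) :
    Bijective (realEval (s.map f).prod T) ↔ ∀ i ∈ s, Bijective (realEval (f i) T) := by
  induction s using Multiset.induction_on with
  | empty =>
    simpa using bijective_realEval_C one_ne_zero T
  | cons i s ih =>
    have h0 : (s.map f).prod ≠ 0 := Multiset.prod_ne_zero (by simp [hf])
    rw [Multiset.map_cons, Multiset.prod_cons, bijective_realEval_mul (hf i) h0, ih]
    simp

end Bijective

/-! ### Closedness in terms of sequences. -/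

section Closed

variable {R V : Type*} [Ring R] [AddCommGroup V] [Module R V]

theorem isClosedOp_iff_seq [TopologicalSpace V] [FirstCountableTopology V] (A : V →ₗ.[R] V) :
    IsClosedOp A ↔ ∀ (u : ℕ → V) (x y : V), (∀ n, u n ∈ A.domain) → Tendsto u atTop (𝓝 x) →
      Tendsto (fun n => extendByZero A (u n)) atTop (𝓝 y) →
      x ∈ A.domain ∧ extendByZero A x = y := by
  have hg (v w : V) : (v, w) ∈ (A.graph : Set (V × V)) ↔
      v ∈ A.domain ∧ extendByZero A v = w := by
    rw [SetLike.mem_coe, LinearPMap.mem_graph_iff]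
    constructor
    · rintro ⟨⟨v, hv⟩, rfl, rfl⟩
      exact ⟨hv, extendByZero_apply A hv⟩
    · rintro ⟨hv, rfl⟩
      exact ⟨⟨v, hv⟩, rfl, (extendByZero_apply A hv).symm⟩
  rw [IsClosedOp, ← isSeqClosed_iff_isClosed]
  constructor
  · intro h u x y hu hx hy
    exact (hg x y).1 (h (fun n => (hg _ _).2 ⟨hu n, rfl⟩) (hx.prodMk_nhds hy))
  · rintro h u ⟨x, y⟩ hu hxy
    have hu' n := (hg (u n).1 (u n).2).1 (hu n)
    refine (hg x y).2 (h (fun n => (u n).1) x y (fun n => (hu' n).1)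
      ((continuous_fst.tendsto _).comp hxy) ?_)
    simp only [fun n => (hu' n).2]
    exact (continuous_snd.tendsto _).comp hxy

theorem extendByZero_realEval [Module ℝ V] [SMulCommClass R ℝ V] (p : ℝ[X]) (T : V →ₗ.[R] V)
    {v : V} (hv : v ∈ (pow T p.natDegree).domain) :
    extendByZero (realEval p T) v = orbitEval T v p := by
  rw [extendByZero_apply _ (by rwa [realEval_domain]), realEval_apply]

theorem isClosedOp_realEval_iff [TopologicalSpace V] [FirstCountableTopology V] [Module ℝ V]
    [SMulCommClass R ℝ V] (p : ℝ[X]) (T : V →ₗ.[R] V) :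
    IsClosedOp (realEval p T) ↔ ∀ (u : ℕ → V) (x y : V),
      (∀ n, u n ∈ (pow T p.natDegree).domain) → Tendsto u atTop (𝓝 x) →
      Tendsto (fun n => orbitEval T (u n) p) atTop (𝓝 y) →
      x ∈ (pow T p.natDegree).domain ∧ orbitEval T x p = y := by
  rw [isClosedOp_iff_seq, realEval_domain]
  refine forall_congr' fun u => forall₂_congr fun x y => forall₂_congr fun hu hx => ?_
  simp only [fun n => extendByZero_realEval p T (hu n)]
  exact imp_congr_right fun _ => and_congr_right fun h => by rw [extendByZero_realEval p T h]

end Closed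

/-! ### Closedness of p(T) and reduction of the resolvent set to bijectivity. -/

section Banach

variable {R V : Type*} [Ring R] [NormedAddCommGroup V] [NormedSpace ℝ V] [Module R V]

/-- An operator maps its domain bijectively onto the whole space and has a bounded inverse. -/
def BoundedlyInvertible (A : V →ₗ.[R] V) : Prop :=
  Bijective A ∧ ∃ B : V →L[R] V, ∀ v : A.domain, B (A v) = v

variable [Algebra ℝ R] [IsScalarTower ℝ R V]

/-- The graph of the inverse is the flipped graph of A, so the closed graph theorem makes the
inverse bounded. -/
theorem IsClosedOp.boundedlyInvertible [CompleteSpace V] {A : V →ₗ.[R] V} (hA : IsClosedOp A) (h : Bijective A) :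
    BoundedlyInvertible A := by
  let e : A.domain ≃ₗ[R] V := LinearEquiv.ofBijective A.toFun h
  let B : V →ₗ[R] V := A.domain.subtype ∘ₗ e.symm.toLinearMap
  have hBA (v : A.domain) : B (A v) = v := congrArg Subtype.val (e.symm_apply_apply v)
  have hAB (w : V) : extendByZero A (B w) = w :=
    (extendByZero_apply A (e.symm w).2).trans (e.apply_symm_apply w)
  have hc : Continuous (B.restrictScalars ℝ) := by
    refine LinearMap.continuous_of_seq_closed_graph _ fun u x y hx hy => ?_
    obtain ⟨h₁, h₂⟩ := (isClosedOp_iff_seq A).1 hA (fun n => B (u n)) y x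
      (fun n => (e.symm (u n)).2) hy (by simpa only [hAB] using hx)
    rw [extendByZero_apply A h₁] at h₂
    rw [← h₂]
    exact (hBA ⟨y, h₁⟩).symm
  exact ⟨h, ⟨⟨B, hc⟩, hBA⟩⟩

variable [SMulCommClass R ℝ V]

/-- Turns the spectral question for p(T) into one about a polynomial in T. Domains agree even for
constant p, since q_s ∘ p has degree 2 deg p. -/
theorem quadratic_realEval (p : ℝ[X]) (T : V →ₗ.[R] V) (s : ℍ[ℝ]) :
    quadratic (realEval p T) s = realEval ((charQuadratic s.re ‖s‖).comp p) T := by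
  have hdom (v : V) : v ∈ (quadratic (realEval p T) s).domain ↔
      v ∈ (pow T (p.natDegree + p.natDegree)).domain := by
    have h1 : v ∈ (quadratic (realEval p T) s).domain ↔
        v ∈ (pow (realEval p T) 2).domain ∧ v ∈ (realEval p T).domain :=
      ⟨fun h => h.1, fun h => ⟨h, trivial⟩⟩
    rw [h1, mem_pow_succ_domain, mem_pow_one_domain, Function.iterate_one, realEval_domain]
    rcases eq_or_ne p 0 with rfl | hp
    · simp
    · constructor
      · rintro ⟨⟨h₁, h₂⟩, -⟩
        rw [extendByZero_realEval p T h₁] at h₂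
        exact mem_pow_domain_of_orbitEval_mem T _ hp h₁ h₂
      · intro h
        have h₁ := pow_domain_antitone T (Nat.le_add_left _ _) h
        rw [extendByZero_realEval p T h₁]
        exact ⟨⟨h₁, (iterate_orbitEval T _ p h).1⟩, h₁⟩
  refine eq_realEval (fun v => ?_) fun v h => ?_
  · rw [hdom, Polynomial.natDegree_comp, natDegree_charQuadratic, two_mul]
  · have hv := (hdom v).1 h
    have h₁ := pow_domain_antitone T (Nat.le_add_left _ _) hv
    have h2 : v ∈ (pow (realEval p T) 2).domain := h.1.1
    have e : quadratic (realEval p T) s ⟨v, h⟩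
        = pow (realEval p T) 2 ⟨v, h2⟩ - (2 * s.re) • realEval p T ⟨v, h.1.2⟩
          + (‖s‖ ^ 2) • v := rfl
    rw [e, pow_apply, realEval_apply, Function.iterate_succ_apply, Function.iterate_one,
      extendByZero_realEval p T h₁,
      extendByZero_realEval p T (iterate_orbitEval T _ p hv).1, orbitEval_orbitEval T p p hv,
      charQuadratic_comp, map_add, map_sub, map_smul, orbitEval_C]

theorem quadratic_eq_realEval (T : V →ₗ.[R] V) (s : ℍ[ℝ]) :
    quadratic T s = realEval (charQuadratic s.re ‖s‖) T := by
  simpa only [realEval_X, Polynomial.comp_X] using quadratic_realEval Polynomial.X T s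

variable [CompleteSpace V]

/-- Strong induction on deg p, in steps of two. Writing p = q g + aX + b and applying B = q(T)⁻¹
gives g(T) v = B p(T) v - (a T B + b B) v, whose right side is continuous in v and p(T) v. -/
theorem isClosedOp_realEval {T : V →ₗ.[R] V} (hT : IsClosedOp T)
    (hne : (sResolventSet T).Nonempty) (p : ℝ[X]) : IsClosedOp (realEval p T) := by
  obtain ⟨s, hbij, B, hB⟩ := hne
  set q := charQuadratic s.re ‖s‖ with hq
  rw [quadratic_eq_realEval] at hbij hB
  have hq2 : q.natDegree = 2 := natDegree_charQuadratic _ _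
  have hqm : q.Monic := charQuadratic_monic _ _
  have hBq {v : V} (hv : v ∈ (pow T 2).domain) : B (orbitEval T v q) = v := by
    have hv' : v ∈ (realEval q T).domain := by rwa [realEval_domain, hq2]
    simpa only [realEval_apply] using hB ⟨v, hv'⟩
  have hqB (w : V) : B w ∈ (pow T 2).domain ∧ orbitEval T (B w) q = w := by
    obtain ⟨⟨v, hv⟩, rfl⟩ := hbij.2 w
    have hv2 : v ∈ (pow T 2).domain := by rwa [realEval_domain, hq2] at hv
    simp only [realEval_apply]
    rw [hBq hv2]
    exact ⟨hv2, rfl⟩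
  have hB1 (w : V) : B w ∈ T.domain :=
    (mem_pow_one_domain T).1 (pow_domain_antitone T one_le_two (hqB w).1)
  -- As q(T) B v = v ∈ D(T), the vector B v lies in D(T³). Then q(T) T B v = T q(T) B v = T v, and B
  -- is applied to both ends.
  have hcomm {v : V} (hv : v ∈ T.domain) : B (extendByZero T v) = extendByZero T (B v) ∧
      extendByZero T (B v) ∈ (pow T 2).domain := by
    have h3 : B v ∈ (pow T (q.natDegree + 1)).domain := by
      refine mem_pow_domain_of_orbitEval_mem T 1 hqm.ne_zero (by rw [hq2]; exact (hqB v).1) ?_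
      rwa [(hqB v).2, mem_pow_one_domain]
    have h12 : extendByZero T (B v) ∈ (pow T 2).domain :=
      iterate_mem_pow_domain (m := 1) T (by rwa [hq2] at h3)
    refine ⟨?_, h12⟩
    rw [← hBq h12]
    congr 1
    have e1 := (iterate_orbitEval T 1 q h3).2
    have e2 := orbitEval_orbitEval T q Polynomial.X (v := B v) (by
      rwa [Polynomial.natDegree_X, add_comm])
    rw [pow_one, Function.iterate_one, (hqB v).2] at e1
    rw [orbitEval_X] at e2
    rw [e1, e2, mul_comm]
  let C : V →ₗ[R] V := T.toFun ∘ₗ B.toLinearMap.codRestrict T.domain hB1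
  have hC (v : V) : C v = extendByZero T (B v) := (extendByZero_apply T (hB1 v)).symm
  -- T B is defined everywhere and inherits a closed graph from T.
  have hCc : Continuous fun v => extendByZero T (B v) := by
    have : Continuous (C.restrictScalars ℝ) := by
      refine LinearMap.continuous_of_seq_closed_graph _ fun u x y hx hy => ?_
      obtain ⟨-, h₂⟩ := (isClosedOp_iff_seq T).1 hT (fun n => B (u n)) (B x) y
        (fun n => hB1 _) ((B.continuous.tendsto x).comp hx)
        (by simp only [← hC]; exact hy)
      exact h₂.symm.trans (hC x).symm
    simp only [← hC]
    exact this
  have hBsmul (r : ℝ) (v : V) : B (r • v) = r • B v := LinearMap.map_smul_of_tower B.toLinearMap r v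
  have hlin {r : ℝ[X]} {a b : ℝ} (hr : r = Polynomial.C a * Polynomial.X + Polynomial.C b)
      (v : V) : orbitEval T v r = a • extendByZero T v + b • v := by
    rw [hr, ← Polynomial.smul_eq_C_mul, map_add, map_smul, orbitEval_X, orbitEval_C]
  induction hn : p.natDegree using Nat.strong_induction_on generalizing p with
  | _ n ih =>
  rw [isClosedOp_realEval_iff, hn]
  intro u x y hu hx hy
  rcases n with _ | _ | n
  · obtain ⟨a, rfl⟩ := Polynomial.natDegree_eq_zero.1 hn
    simp only [orbitEval_C] at hy ⊢
    exact ⟨trivial, tendsto_nhds_unique (hx.const_smul a) hy⟩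
  · obtain ⟨a, ha, b, rfl⟩ := Polynomial.natDegree_eq_one.1 hn
    simp only [hlin rfl, mem_pow_one_domain, zero_add] at hy hu ⊢
    have h := (isClosedOp_iff_seq T).1 hT u x (a⁻¹ • (y - b • x)) hu hx (by
      refine ((hy.sub (hx.const_smul b)).const_smul a⁻¹).congr fun n => ?_
      rw [add_sub_cancel_right, inv_smul_smul₀ ha])
    refine ⟨h.1, ?_⟩
    rw [h.2, smul_inv_smul₀ ha, sub_add_cancel]
  · set g := p /ₘ q with hgdef
    have hgn : g.natDegree = n := by
      rw [hgdef, Polynomial.natDegree_divByMonic p hqm, hn, hq2]; rfl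
    have hg0 : g ≠ 0 := fun h => by
      have := Polynomial.natDegree_lt_natDegree (fun h => by simp [h] at hn)
        ((Polynomial.divByMonic_eq_zero_iff hqm).1 h)
      omega
    obtain ⟨a, b, hab⟩ : ∃ a b, p %ₘ q = Polynomial.C a * Polynomial.X + Polynomial.C b := by
      refine Polynomial.exists_eq_X_add_C_of_natDegree_le_one ?_
      have := Polynomial.natDegree_modByMonic_lt p hqm (fun h => by simp [h] at hq2)
      omega
    have hdiv : p = q * g + (Polynomial.C a * Polynomial.X + Polynomial.C b) := by
      rw [← hab, add_comm]; exact (Polynomial.modByMonic_add_div p q).symm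
    have hexp {v : V} (hv : v ∈ (pow T (n + 2)).domain) : orbitEval T v p
        = orbitEval T (orbitEval T v g) q + (a • extendByZero T v + b • v) := by
      conv_lhs => rw [hdiv]
      rw [map_add, hlin rfl, orbitEval_orbitEval T q g (by rwa [hgn, hq2])]
    have hgB {v : V} (hv : v ∈ (pow T (n + 2)).domain) : orbitEval T v g
        = B (orbitEval T v p) - (a • extendByZero T (B v) + b • B v) := by
      have hv1 : v ∈ T.domain := (mem_pow_one_domain T).1 (pow_domain_antitone T (by omega) hv)
      have hgv : orbitEval T v g ∈ (pow T 2).domain :=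
        (iterate_orbitEval T 2 g (by rwa [hgn])).1
      rw [hexp hv, map_add, map_add, hBq hgv, hBsmul, hBsmul, (hcomm hv1).1, add_sub_cancel_right]
    have hgc := (isClosedOp_realEval_iff g T).1 (ih n (by omega) g hgn) u x
      (B y - (a • extendByZero T (B x) + b • B x))
      (fun k => by rw [hgn]; exact pow_domain_antitone T (by omega) (hu k)) hx (by
        simp only [fun k => hgB (hu k)]
        exact ((B.continuous.tendsto y).comp hy).sub
          ((((hCc.tendsto x).comp hx).const_smul a).add
            (((B.continuous.tendsto x).comp hx).const_smul b)))
    obtain ⟨hxg, hgx⟩ := hgc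
    -- Regularity is gained in two stages. At first T B x is only known to lie in D(T), which makes
    -- g(T) x ∈ D(T) and hence x ∈ D(T).
    have hx1 : x ∈ T.domain := by
      refine (mem_pow_one_domain T).1 (pow_domain_antitone T (Nat.le_add_left 1 g.natDegree)
        (mem_pow_domain_of_orbitEval_mem T 1 hg0 hxg ?_))
      rw [hgx]
      have h12 (w : V) : B w ∈ (pow T 1).domain := pow_domain_antitone T one_le_two (hqB w).1
      exact Submodule.sub_mem _ (h12 y) (Submodule.add_mem _
        (real_smul_mem _ a (iterate_mem_pow_domain (m := 1) (n := 1) T (hqB x).1))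
        (real_smul_mem _ b (h12 x)))
    -- Now T B x = B T x, so g(T) x = B(y - (a T x + b x)) lies in D(T²), and x gains the remaining
    -- regularity.
    rw [← (hcomm hx1).1, ← hBsmul, ← hBsmul, ← map_add, ← map_sub] at hgx
    have hxn : x ∈ (pow T (n + 2)).domain := by
      rw [← hgn]
      exact mem_pow_domain_of_orbitEval_mem T 2 hg0 hxg (by rw [hgx]; exact (hqB _).1)
    refine ⟨hxn, ?_⟩
    rw [hexp hxn, hgx, (hqB _).2, sub_add_cancel]

theorem mem_sResolventSet_realEval_iff_bijective {T : V →ₗ.[R] V} (hT : IsClosedOp T)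
    (hne : (sResolventSet T).Nonempty) (p : ℝ[X]) (s : ℍ[ℝ]) :
    s ∈ sResolventSet (realEval p T) ↔
      Bijective (realEval ((charQuadratic s.re ‖s‖).comp p) T) := by
  rw [← quadratic_realEval]
  refine ⟨fun h => h.1, fun h => ?_⟩
  exact IsClosedOp.boundedlyInvertible (by
    rw [quadratic_realEval]; exact isClosedOp_realEval hT hne _) h

theorem mem_sResolventSet_iff_bijective {T : V →ₗ.[R] V} (hT : IsClosedOp T)
    (hne : (sResolventSet T).Nonempty) (s : ℍ[ℝ]) :
    s ∈ sResolventSet T ↔ Bijective (realEval (charQuadratic s.re ‖s‖) T) := by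
  simpa only [realEval_X, Polynomial.comp_X] using
    mem_sResolventSet_realEval_iff_bijective hT hne Polynomial.X s

end Banach

/-! ### Factorization of q_z ∘ p into real quadratics. -/

section Factorization

open Polynomial ComplexConjugate

theorem map_charQuadratic (z : ℂ) : (charQuadratic z.re ‖z‖).map (algebraMap ℝ ℂ)
    = (X - C z) * (X - C (conj z)) := by
  have h₁ : ((2 * z.re : ℝ) : ℂ) = z + conj z := (Complex.add_conj z).symm
  have h₂ : ((‖z‖ ^ 2 : ℝ) : ℂ) = z * conj z := by
    rw [Complex.mul_conj, Complex.normSq_eq_norm_sq]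
  simp only [charQuadratic, Polynomial.map_add, Polynomial.map_sub, Polynomial.map_mul,
    Polynomial.map_pow, map_X, map_C, Complex.coe_algebraMap, h₂]
  rw [h₁, C_add, C_mul]
  ring

/-- A real polynomial of the form `P ^ 2 - 2 Re(z) P + |z| ^ 2` is, up to a constant, the product
of the real quadratics attached to the complex solutions of `P = z`. -/
theorem charQuadratic_comp_eq_prod {p : ℝ[X]} (hp : 1 ≤ p.natDegree) (z : ℂ) :
    ∃ c : ℝ, c ≠ 0 ∧ (charQuadratic z.re ‖z‖).comp p
      = C c * (((p.map (algebraMap ℝ ℂ) - C z).roots).map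
          fun w => charQuadratic w.re ‖w‖).prod := by
  set f := p.map (algebraMap ℝ ℂ) - C z with hf
  have hfd : f.natDegree = p.natDegree := by
    rw [hf, natDegree_sub_C, natDegree_map]
  have hlead : f.leadingCoeff = ((p.leadingCoeff : ℝ) : ℂ) := by
    rw [leadingCoeff, hfd, hf, coeff_sub, coeff_C, if_neg (by omega), sub_zero, coeff_map]
    rfl
  have hprod := (IsAlgClosed.splits f).eq_prod_roots
  have hconj : f.map (starRingEnd ℂ) = p.map (algebraMap ℝ ℂ) - C (conj z) := by
    rw [hf, Polynomial.map_sub, map_C, Polynomial.map_map]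
    congr 2
    ext x
    simp
  have hprod' := congrArg (Polynomial.map (starRingEnd ℂ)) hprod
  rw [hconj, Polynomial.map_mul, map_C, hlead, Complex.conj_ofReal, Polynomial.map_multiset_prod,
    Multiset.map_map] at hprod'
  have hp0 : p ≠ 0 := fun h => by simp [h] at hp
  -- Each of p - z and p - z̄ contributes one leading coefficient; the roots of the second are the
  -- conjugates of those of the first.
  refine ⟨p.leadingCoeff ^ 2, pow_ne_zero 2 (leadingCoeff_ne_zero.2 hp0), ?_⟩
  refine map_injective (algebraMap ℝ ℂ) (algebraMap ℝ ℂ).injective ?_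
  rw [map_comp, map_charQuadratic, Polynomial.map_mul, map_C, Polynomial.map_multiset_prod,
    Multiset.map_map, mul_comp, sub_comp, sub_comp, X_comp, C_comp, C_comp, ← hf, hprod', hprod,
    hlead]
  -- Rewriting by the factorization also replaced f inside `f.roots`; this undoes it there.
  have hr : (C ((p.leadingCoeff : ℂ)) * (f.roots.map fun x => X - C x).prod).roots = f.roots := by
    rw [← hlead, ← hprod]
  simp only [hr, Function.comp_def, map_charQuadratic, Multiset.prod_map_mul, Polynomial.map_sub,
    map_X, map_C, map_pow, Complex.coe_algebraMap]
  ring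

end Factorization

end UnboundedOp

/-! ### Intrinsic polynomials have real coefficients; complex slices of ℍ. -/

open Polynomial in
-- Real x are scalars for f, so f(P(x)) is a real polynomial in x with coefficients f(a_k). Used
-- with f an imaginary coordinate.
theorem eval_coe_eq_zero_imp_coeff (f : ℍ[ℝ] →ₗ[ℝ] ℝ) {P : ℍ[ℝ][X]}
    (h : ∀ x : ℝ, f (P.eval (x : ℍ[ℝ])) = 0) (l : ℕ) : f (P.coeff l) = 0 := by
  let r : ℝ[X] := ∑ k ∈ Finset.range (P.natDegree + 1), monomial k (f (P.coeff k))
  have hr : r = 0 := by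
    refine Polynomial.funext fun x => ?_
    rw [eval_zero, ← h x, eval_finsetSum, eval_eq_sum_range, map_sum]
    refine Finset.sum_congr rfl fun k _ => ?_
    rw [eval_monomial, ← Quaternion.coe_pow, Quaternion.mul_coe_eq_smul, map_smul, smul_eq_mul,
      mul_comm]
  rcases lt_or_ge P.natDegree l with hl | hl
  · rw [coeff_eq_zero_of_natDegree_lt hl, map_zero]
  · have := congrArg (coeff · l) hr
    simpa [r, finsetSum_coeff, coeff_monomial, Nat.lt_succ_iff, hl] using this

/-- Two units suffice: the planes of I and J meet in ℝ and both contain every real x, so P is real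
on ℝ. -/
theorem IsIntrinsicPolynomial.exists_real {P : ℍ[ℝ][X]} (hP : IsIntrinsicPolynomial P) :
    ∃ p : ℝ[X], P = p.map (algebraMap ℝ ℍ[ℝ]) := by
  obtain ⟨I, hI₀, hI₁, hI₂, hI₃⟩ : ∃ I : ℍ[ℝ], I.re = 0 ∧ I.imI = 1 ∧ I.imJ = 0 ∧ I.imK = 0 :=
    ⟨⟨0, 1, 0, 0⟩, rfl, rfl, rfl, rfl⟩
  obtain ⟨J, hJ₀, hJ₁, hJ₂, hJ₃⟩ : ∃ J : ℍ[ℝ], J.re = 0 ∧ J.imI = 0 ∧ J.imJ = 1 ∧ J.imK = 0 :=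
    ⟨⟨0, 0, 1, 0⟩, rfl, rfl, rfl, rfl⟩
  have hI : I ∈ imaginaryUnits := by
    change I ^ 2 = -1
    rw [sq]; ext <;> simp [hI₀, hI₁, hI₂, hI₃]
  have hJ : J ∈ imaginaryUnits := by
    change J ^ 2 = -1
    rw [sq]; ext <;> simp [hJ₀, hJ₁, hJ₂, hJ₃]
  have hreal (x : ℝ) : (P.eval (x : ℍ[ℝ])).imI = 0 ∧ (P.eval (x : ℍ[ℝ])).imJ = 0 ∧
      (P.eval (x : ℍ[ℝ])).imK = 0 := by
    obtain ⟨u, v, h₁⟩ := hP I hI x ⟨x, 0, by simp⟩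
    obtain ⟨u', v', h₂⟩ := hP J hJ x ⟨x, 0, by simp⟩
    refine ⟨?_, ?_, ?_⟩
    · rw [h₂]; simp [hJ₀, hJ₁, hJ₂, hJ₃]
    · rw [h₁]; simp [hI₀, hI₁, hI₂, hI₃]
    · rw [h₁]; simp [hI₀, hI₁, hI₂, hI₃]
  let fI : ℍ[ℝ] →ₗ[ℝ] ℝ := ⟨⟨fun q => q.imI, fun _ _ => rfl⟩, fun _ _ => rfl⟩
  let fJ : ℍ[ℝ] →ₗ[ℝ] ℝ := ⟨⟨fun q => q.imJ, fun _ _ => rfl⟩, fun _ _ => rfl⟩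
  let fK : ℍ[ℝ] →ₗ[ℝ] ℝ := ⟨⟨fun q => q.imK, fun _ _ => rfl⟩, fun _ _ => rfl⟩
  have hmem : P ∈ Polynomial.lifts (algebraMap ℝ ℍ[ℝ]) := by
    rw [Polynomial.lifts_iff_coeff_lifts]
    intro l
    refine ⟨(P.coeff l).re, ?_⟩
    have h₁ : (P.coeff l).imI = 0 := eval_coe_eq_zero_imp_coeff fI (fun x => (hreal x).1) l
    have h₂ : (P.coeff l).imJ = 0 := eval_coe_eq_zero_imp_coeff fJ (fun x => (hreal x).2.1) l
    have h₃ : (P.coeff l).imK = 0 := eval_coe_eq_zero_imp_coeff fK (fun x => (hreal x).2.2) l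
    rw [Quaternion.algebraMap_def]
    ext <;> simp [h₁, h₂, h₃]
  obtain ⟨p, hp⟩ := (Polynomial.mem_lifts P).1 hmem
  exact ⟨p, hp.symm⟩

/-- Every quaternion lies in the image of an isometric embedding of `ℂ` into `ℍ`. -/
theorem Quaternion.exists_complex_slice (q : ℍ[ℝ]) :
    ∃ (φ : ℂ →ₐ[ℝ] ℍ[ℝ]) (z : ℂ), φ z = q ∧ ∀ w, (φ w).re = w.re ∧ ‖φ w‖ = ‖w‖ := by
  obtain ⟨i, r, hi, hn, hq⟩ : ∃ (i : ℍ[ℝ]) (r : ℝ), i.re = 0 ∧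
      i.imI ^ 2 + i.imJ ^ 2 + i.imK ^ 2 = 1 ∧ q = (q.re : ℍ[ℝ]) + r • i := by
    by_cases h : q.im = 0
    -- A real q lies in every slice, so any imaginary unit serves.
    · refine ⟨⟨0, 1, 0, 0⟩, 0, rfl, by norm_num, ?_⟩
      refine Eq.trans ?_ ((congrArg _ (zero_smul ℝ _)).trans (add_zero _)).symm
      conv_lhs => rw [← Quaternion.re_add_im q, h, add_zero]
    · have h0 : ‖q.im‖ ≠ 0 := norm_ne_zero_iff.2 h
      refine ⟨‖q.im‖⁻¹ • q.im, ‖q.im‖, by simp, ?_, ?_⟩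
      · have hns : ‖q.im‖ ^ 2 = q.imI ^ 2 + q.imJ ^ 2 + q.imK ^ 2 := by
          rw [sq, ← Quaternion.normSq_eq_norm_mul_self, Quaternion.normSq_def']
          simp
        simp only [Quaternion.imI_smul, Quaternion.imJ_smul, Quaternion.imK_smul, smul_eq_mul,
          Quaternion.imI_im, Quaternion.imJ_im, Quaternion.imK_im, mul_pow]
        rw [← mul_add, ← mul_add, ← hns, ← mul_pow, inv_mul_cancel₀ h0, one_pow]
      · rw [smul_inv_smul₀ h0, Quaternion.re_add_im]
  have hii : i * i = -1 := by
    ext <;> simp [hi] <;> linarith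
  refine ⟨Complex.lift ⟨i, hii⟩, ⟨q.re, r⟩, ?_, fun w => ?_⟩
  · rw [Complex.lift_apply, Complex.liftAux_apply, Quaternion.algebraMap_def, ← hq]
  · rw [Complex.lift_apply, Complex.liftAux_apply, Quaternion.algebraMap_def]
    refine ⟨by simp [hi], ?_⟩
    rw [← sq_eq_sq₀ (norm_nonneg _) (norm_nonneg _), sq, ← Quaternion.normSq_eq_norm_mul_self,
      ← Complex.normSq_eq_norm_sq, Quaternion.normSq_def', Complex.normSq_apply]
    simp [hi]
    linear_combination w.im ^ 2 * hn

/-! ### The spectral mapping theorem. -/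

namespace UnboundedOp

open Polynomial

variable {R V : Type*} [Ring R] [NormedAddCommGroup V] [NormedSpace ℝ V] [Module R V]
  [SMulCommClass R ℝ V]

/-- A polynomial operator whose coefficients act as real scalars is the one with real
coefficients. -/
theorem polySum_eq_realEval {S : Type*} [Monoid S] [DistribMulAction S V] [SMulCommClass R S V]
    (p : ℝ[X]) (n : ℕ) (hn : n = p.natDegree) (a : ℕ → S)
    (ha : ∀ l (v : V), a l • v = p.coeff l • v) (T : V →ₗ.[R] V) :
    polySum n a T = realEval p T := by
  subst hn
  refine eq_realEval (fun v => by rw [polySum_domain]) fun v h => ?_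
  rw [polySum_apply, orbitEval_eq_sum]
  exact Finset.sum_congr rfl fun l _ => ha l _

variable [Algebra ℝ R] [IsScalarTower ℝ R V] [CompleteSpace V]

/-- Here q_s(a) = |s - a|², so the quadratic operator is this multiple of the identity. -/
theorem mem_sSpectrum_realEval_C_iff [Nontrivial V] {T : V →ₗ.[R] V} (hT : IsClosedOp T)
    (hne : (sResolventSet T).Nonempty) (a : ℝ) (s : ℍ[ℝ]) :
    s ∈ sSpectrum (realEval (C a) T) ↔ s = a := by
  have hev : (charQuadratic s.re ‖s‖).eval a = Quaternion.normSq (s - (a : ℍ[ℝ])) := by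
    simp only [charQuadratic, eval_add, eval_sub, eval_pow, eval_X, eval_mul, eval_C]
    rw [sq ‖s‖, ← Quaternion.normSq_eq_norm_mul_self, Quaternion.normSq_def',
      Quaternion.normSq_def']
    simp
    ring
  rw [sSpectrum, Set.mem_compl_iff, mem_sResolventSet_realEval_iff_bijective hT hne, comp_C, hev,
    not_iff_comm]
  constructor
  · intro h
    exact bijective_realEval_C (fun h0 => h (sub_eq_zero.1 (Quaternion.normSq_eq_zero.1 h0))) T
  · rintro h rfl
    rw [sub_self, map_zero, C_0] at h
    obtain ⟨v, hv⟩ := exists_ne (0 : V)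
    obtain ⟨w, hw⟩ := h.2 v
    exact hv (hw.symm.trans (realEval_zero_apply T w))

/-- The quadratic q_s depends only on Re s and |s|, which φ preserves; so the complex roots w of p =
z describe all factors of q_s ∘ p. -/
theorem mem_sResolventSet_realEval_iff {T : V →ₗ.[R] V} (hT : IsClosedOp T)
    (hne : (sResolventSet T).Nonempty) {p : ℝ[X]} (hp : 1 ≤ p.natDegree) (φ : ℂ →ₐ[ℝ] ℍ[ℝ])
    (hφ : ∀ w, (φ w).re = w.re ∧ ‖φ w‖ = ‖w‖) (z : ℂ) :
    φ z ∈ sResolventSet (realEval p T) ↔ ∀ w, aeval w p = z → φ w ∈ sResolventSet T := by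
  obtain ⟨c, hc, h⟩ := charQuadratic_comp_eq_prod hp z
  have h0 (w : ℂ) : charQuadratic w.re ‖w‖ ≠ 0 := (charQuadratic_monic _ _).ne_zero
  have hf : p.map (algebraMap ℝ ℂ) - C z ≠ 0 := fun hf => by
    have := congrArg natDegree hf
    rw [natDegree_sub_C, natDegree_map, natDegree_zero] at this
    omega
  rw [mem_sResolventSet_realEval_iff_bijective hT hne, (hφ z).1, (hφ z).2, h,
    bijective_realEval_mul (C_ne_zero.2 hc) (Multiset.prod_ne_zero (by simp [h0])),
    and_iff_right (bijective_realEval_C hc T), bijective_realEval_multiset_prod _ _ h0]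
  refine forall_congr' fun w => ?_
  rw [mem_sResolventSet_iff_bijective hT hne, (hφ w).1, (hφ w).2, mem_roots hf, IsRoot.def,
    eval_sub, eval_C, eval_map_algebraMap, sub_eq_zero]

theorem image_sSpectrum_eq {T : V →ₗ.[R] V} (hT : IsClosedOp T)
    (hne : (sResolventSet T).Nonempty) (p : ℝ[X])
    (h : 1 ≤ p.natDegree ∨ (sSpectrum T).Nonempty) :
    (fun q => (p.map (algebraMap ℝ ℍ[ℝ])).eval q) '' sSpectrum T = sSpectrum (realEval p T) := by
  have hev (φ : ℂ →ₐ[ℝ] ℍ[ℝ]) (w : ℂ) :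
      (p.map (algebraMap ℝ ℍ[ℝ])).eval (φ w) = φ (aeval w p) := by
    rw [eval_map_algebraMap, aeval_algHom_apply]
  rcases Nat.eq_zero_or_pos p.natDegree with hp | hp
  · obtain ⟨a, rfl⟩ := natDegree_eq_zero.1 hp
    obtain ⟨t, ht⟩ : (sSpectrum T).Nonempty := h.resolve_left (by omega)
    -- On V = 0 every operator is bijective and the spectrum is empty.
    have : Nontrivial V := by
      by_contra hV
      rw [not_nontrivial_iff_subsingleton] at hV
      refine ht ((mem_sResolventSet_iff_bijective hT hne t).2
        ⟨fun v w _ => Subsingleton.elim v w, fun w => ⟨0, Subsingleton.elim _ _⟩⟩)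
    ext s
    rw [mem_sSpectrum_realEval_C_iff hT hne, map_C, Quaternion.algebraMap_def]
    constructor
    · rintro ⟨q, -, rfl⟩
      exact eval_C
    · rintro rfl
      exact ⟨t, ht, eval_C⟩
  · ext s
    constructor
    · rintro ⟨q, hq, rfl⟩
      obtain ⟨φ, w, rfl, hφ⟩ := Quaternion.exists_complex_slice q
      intro hs
      beta_reduce at hs
      rw [hev, mem_sResolventSet_realEval_iff hT hne hp φ hφ] at hs
      exact hq (hs w rfl)
    · intro hs
      obtain ⟨φ, z, rfl, hφ⟩ := Quaternion.exists_complex_slice s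
      rw [sSpectrum, Set.mem_compl_iff, mem_sResolventSet_realEval_iff hT hne hp φ hφ] at hs
      push Not at hs
      obtain ⟨w, rfl, hw⟩ := hs
      exact ⟨φ w, hw, hev φ w⟩

/-- Products, inverses, closedness and spectra of polynomials in an operator. -/
theorem realEval_calculus {p q : ℝ[X]} {T A B C : V →ₗ.[R] V} (hA : A = realEval p T)
    (hB : B = realEval q T) (hC : C = realEval (p * q) T) :
    (p ≠ 0 → prod A B = C) ∧
    (Injective A → q ≠ 0 →
      A.inverse.domain ⊓ B.domain ≤ (prod A.inverse B).domain ⊓ (prod B A.inverse).domain ∧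
      ∀ (v : V) (h₁ : v ∈ (prod A.inverse B).domain) (h₂ : v ∈ (prod B A.inverse).domain),
        v ∈ B.domain → v ∈ A.inverse.domain →
        prod A.inverse B ⟨v, h₁⟩ = prod B A.inverse ⟨v, h₂⟩) ∧
    (IsClosedOp T → (sResolventSet T).Nonempty → IsClosedOp A ∧
      ((1 ≤ p.natDegree ∨ (sSpectrum T).Nonempty) →
        (fun q => (p.map (algebraMap ℝ ℍ[ℝ])).eval q) '' sSpectrum T = sSpectrum A)) := by
  subst hA hB hC
  exact ⟨fun hp => prod_realEval hp q T,
    fun hp hq => inverse_commutes hp (realEval_prod_comm_of_injective hq T hp),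
    fun hT hne => ⟨isClosedOp_realEval hT hne p, image_sSpectrum_eq hT hne p⟩⟩

end UnboundedOp

theorem proposition3p10 {V : Type*} [NormedAddCommGroup V] [NormedSpace ℝ V] [CompleteSpace V]
    [Module ℍ[ℝ] V] [Module ℍ[ℝ]ᵐᵒᵖ V] [SMulCommClass ℍ[ℝ] ℍ[ℝ]ᵐᵒᵖ V]
    [SMulCommClass ℍ[ℝ]ᵐᵒᵖ ℍ[ℝ] V]
    [IsScalarTower ℝ ℍ[ℝ] V] [IsScalarTower ℝ ℍ[ℝ]ᵐᵒᵖ V]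
    [ContinuousSMul ℍ[ℝ] V] [ContinuousSMul ℍ[ℝ]ᵐᵒᵖ V]
    (P Q : ℍ[ℝ][X]) (hP : IsIntrinsicPolynomial P) (hQ : IsIntrinsicPolynomial Q) :
    -- right linear operators
    (∀ T : V →ₗ.[ℍ[ℝ]ᵐᵒᵖ] V,
      (P ≠ 0 → UnboundedOp.prod (UnboundedOp.evalRight P T) (UnboundedOp.evalRight Q T)
        = UnboundedOp.evalRight (P * Q) T) ∧
      (UnboundedOp.Injective (UnboundedOp.evalRight P T) → Q ≠ 0 →
        (UnboundedOp.evalRight P T).inverse.domain ⊓ (UnboundedOp.evalRight Q T).domain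
            ≤ (UnboundedOp.prod (UnboundedOp.evalRight P T).inverse
                (UnboundedOp.evalRight Q T)).domain
              ⊓ (UnboundedOp.prod (UnboundedOp.evalRight Q T)
                (UnboundedOp.evalRight P T).inverse).domain ∧
        ∀ (v : V)
          (h₁ : v ∈ (UnboundedOp.prod (UnboundedOp.evalRight P T).inverse
            (UnboundedOp.evalRight Q T)).domain)
          (h₂ : v ∈ (UnboundedOp.prod (UnboundedOp.evalRight Q T)
            (UnboundedOp.evalRight P T).inverse).domain),
          v ∈ (UnboundedOp.evalRight Q T).domain →
          v ∈ (UnboundedOp.evalRight P T).inverse.domain →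
          UnboundedOp.prod (UnboundedOp.evalRight P T).inverse
              (UnboundedOp.evalRight Q T) ⟨v, h₁⟩
            = UnboundedOp.prod (UnboundedOp.evalRight Q T)
              (UnboundedOp.evalRight P T).inverse ⟨v, h₂⟩) ∧
      (UnboundedOp.IsClosedOp T → (UnboundedOp.sResolventSet T).Nonempty →
        UnboundedOp.IsClosedOp (UnboundedOp.evalRight P T) ∧
        ((1 ≤ P.natDegree ∨ (UnboundedOp.sSpectrum T).Nonempty) →
          (fun q => P.eval q) '' UnboundedOp.sSpectrum T
            = UnboundedOp.sSpectrum (UnboundedOp.evalRight P T)))) ∧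
    -- left linear operators
    (∀ T : V →ₗ.[ℍ[ℝ]] V,
      (P ≠ 0 → UnboundedOp.prod (UnboundedOp.evalLeft P T) (UnboundedOp.evalLeft Q T)
        = UnboundedOp.evalLeft (P * Q) T) ∧
      (UnboundedOp.Injective (UnboundedOp.evalLeft P T) → Q ≠ 0 →
        (UnboundedOp.evalLeft P T).inverse.domain ⊓ (UnboundedOp.evalLeft Q T).domain
            ≤ (UnboundedOp.prod (UnboundedOp.evalLeft P T).inverse
                (UnboundedOp.evalLeft Q T)).domain
              ⊓ (UnboundedOp.prod (UnboundedOp.evalLeft Q T)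
                (UnboundedOp.evalLeft P T).inverse).domain ∧
        ∀ (v : V)
          (h₁ : v ∈ (UnboundedOp.prod (UnboundedOp.evalLeft P T).inverse
            (UnboundedOp.evalLeft Q T)).domain)
          (h₂ : v ∈ (UnboundedOp.prod (UnboundedOp.evalLeft Q T)
            (UnboundedOp.evalLeft P T).inverse).domain),
          v ∈ (UnboundedOp.evalLeft Q T).domain →
          v ∈ (UnboundedOp.evalLeft P T).inverse.domain →
          UnboundedOp.prod (UnboundedOp.evalLeft P T).inverse
              (UnboundedOp.evalLeft Q T) ⟨v, h₁⟩
            = UnboundedOp.prod (UnboundedOp.evalLeft Q T)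
              (UnboundedOp.evalLeft P T).inverse ⟨v, h₂⟩) ∧
      (UnboundedOp.IsClosedOp T → (UnboundedOp.sResolventSet T).Nonempty →
        UnboundedOp.IsClosedOp (UnboundedOp.evalLeft P T) ∧
        ((1 ≤ P.natDegree ∨ (UnboundedOp.sSpectrum T).Nonempty) →
          (fun q => P.eval q) '' UnboundedOp.sSpectrum T
            = UnboundedOp.sSpectrum (UnboundedOp.evalLeft P T)))) := by
  -- Once the coefficients are real, `evalRight` and `evalLeft` are both `realEval`, and the two
  -- halves are instances of one statement.
  obtain ⟨p, rfl⟩ := hP.exists_real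
  obtain ⟨q, rfl⟩ := hQ.exists_real
  have hinj : Function.Injective (algebraMap ℝ ℍ[ℝ]) := (algebraMap ℝ ℍ[ℝ]).injective
  have hdeg (r : ℝ[X]) : (r.map (algebraMap ℝ ℍ[ℝ])).natDegree = r.natDegree :=
    Polynomial.natDegree_map_eq_of_injective hinj r
  have hR (r : ℝ[X]) (T : V →ₗ.[ℍ[ℝ]ᵐᵒᵖ] V) :
      UnboundedOp.evalRight (r.map (algebraMap ℝ ℍ[ℝ])) T = UnboundedOp.realEval r T :=
    UnboundedOp.polySum_eq_realEval r _ (hdeg r) _ (fun l v => by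
      rw [Polynomial.coeff_map, algebraMap_smul]) T
  have hL (r : ℝ[X]) (T : V →ₗ.[ℍ[ℝ]] V) :
      UnboundedOp.evalLeft (r.map (algebraMap ℝ ℍ[ℝ])) T = UnboundedOp.realEval r T :=
    UnboundedOp.polySum_eq_realEval r _ (hdeg r) _ (fun l v => by
      rw [Polynomial.coeff_map, ← MulOpposite.algebraMap_apply, algebraMap_smul]) T
  simp only [← Polynomial.map_mul, hdeg, Polynomial.map_ne_zero_iff hinj]
  exact ⟨fun T => UnboundedOp.realEval_calculus (hR p T) (hR q T) (hR _ T),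
    fun T => UnboundedOp.realEval_calculus (hL p T) (hL q T) (hL _ T)⟩
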